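/- For an integer $n\ge 1$, construct a sequence of pairs of integers as follows. Begin with $\langle 1,y_1\rangle=\langle 1,n\rangle$. Given a pair $\langle i,y_i\rangle$ with $y_i>i$, the next pair is $\langle i+1,y_{i+1}\rangle$, where $y_{i+1}$ is the smallest integer with $(i+1)\,y_{i+1}>i\,(y_i+1)$; the sequence stops at the first pair $\langle i,y_i\rangle$ with $y_i\le i$ (this always happens). The first entry of the final pair is called the strange root of $n$ and is denoted $\mathsf{sr}(n)$. Then for every natural number $k$ the number of integers $n\ge 1$ with $\mathsf{sr}(n)<k$ is finite, and it is asymptotically equal to $k^2/\pi$: $$\lim_{k\to\infty}\frac{\bigl|\{n\ge 1:\mathsf{sr}(n)<k\}\bigr|}{k^2/\pi}=1 .$$ -/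

import Mathlib

/-- The second entry of the pair that follows `⟨i, y⟩`: the smallest integer `z` with
`(i + 1) * z > i * (y + 1)` (see `isLeast_nextEntry`). -/
def nextEntry (i y : ℕ) : ℕ := i * (y + 1) / (i + 1) + 1

theorem isLeast_nextEntry (i y : ℕ) :
    IsLeast {z : ℤ | (i : ℤ) * (y + 1) < (i + 1) * z} (nextEntry i y : ℤ) := by
  have key : (nextEntry i y : ℤ) = (i : ℤ) * (y + 1) / (i + 1) + 1 := by
    unfold nextEntry
    push_cast
    rfl
  have hpos : (0 : ℤ) < (i : ℤ) + 1 := by positivity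
  rw [key]
  constructor
  · have h := Int.lt_ediv_add_one_mul_self ((i : ℤ) * (y + 1)) hpos
    rw [Set.mem_ofPred_eq, mul_comm ((i : ℤ) + 1)]
    exact h
  · intro z hz
    rw [Set.mem_ofPred_eq, mul_comm ((i : ℤ) + 1)] at hz
    exact Int.add_one_le_iff.mpr (Int.ediv_lt_of_lt_mul hpos hz)

theorem nextEntry_le {i y : ℕ} (h : i < y) : nextEntry i y ≤ y := by
  have : i * (y + 1) / (i + 1) < y := by
    rw [Nat.div_lt_iff_lt_mul (Nat.succ_pos i)]
    nlinarith
  exact this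

/-- The final pair reached from `⟨i, y⟩` by replacing, as long as `y > i`, the current pair
`⟨i, y⟩` by `⟨i + 1, nextEntry i y⟩`. -/
def finalPair (i y : ℕ) : ℕ × ℕ :=
  if i < y then finalPair (i + 1) (nextEntry i y) else (i, y)
termination_by y - i
decreasing_by
  rename_i h
  have := nextEntry_le h
  omega

/-- The strange root of `n ≥ 1`: the first entry of the final pair of the sequence of pairs
that begins with `⟨1, n⟩`. -/
def strangeRoot (n : ℕ) : ℕ := (finalPair 1 n).1

/-! Run backwards from index `m + 1`, the construction shows that `strangeRoot n < m + 2` holds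
exactly for `n ≤ maxStart m m + 1`, where a backward step from `⟨r, q⟩` leads to
`⟨r - 1, q + q / r - 1⟩`. While `q / r = a + 1` the quantity `q + a * r` is conserved. So if the
quotient reaches `a + 1` at `r ≈ s m`, where `q ≈ (a + 1) r`, it reaches `a + 2` at
`r ≈ (2 a + 1) / (2 a + 2) * s m`, which gives `s = centralBinom a / 4 ^ a`. The product
`(r + 1) * q` decreases by at most `r * (r + 1)` in all the remaining steps and never increases,
hence `maxStart m m / m ^ 2` lies asymptotically between `a s ^ 2` and `(a + 1) s ^ 2`. Both bounds
tend to `1 / π` as `a → ∞`, by the Wallis product. -/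

open Filter Topology Asymptotics

theorem tendsto_of_tendsto_bounds {ι β α : Type*} [TopologicalSpace α] [LinearOrder α]
    [OrderTopology α] {G : Filter ι} [G.NeBot] {F : Filter β} {f : β → α} {l u : ι → β → α}
    {L U : ι → α} {c : α} (hl : ∀ a, Tendsto (l a) F (𝓝 (L a)))
    (hu : ∀ a, Tendsto (u a) F (𝓝 (U a))) (hL : Tendsto L G (𝓝 c)) (hU : Tendsto U G (𝓝 c))
    (hlf : ∀ a b, l a b ≤ f b) (hfu : ∀ a b, f b ≤ u a b) : Tendsto f F (𝓝 c) := by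
  refine tendsto_order.2 ⟨fun x hx => ?_, fun x hx => ?_⟩
  · obtain ⟨a, ha⟩ := (hL.eventually_const_lt hx).exists
    exact ((hl a).eventually_const_lt ha).mono fun b hb => hb.trans_le (hlf a b)
  · obtain ⟨a, ha⟩ := (hU.eventually_lt_const hx).exists
    exact ((hu a).eventually_lt_const ha).mono fun b hb => (hfu a b).trans_lt hb

theorem tendsto_natCast_div_div {ι : Type*} {F : Filter ι} {x : ι → ℕ} {t : ι → ℝ} {X : ℝ}
    (ht : Tendsto t F atTop) (hx : Tendsto (fun i => x i / t i) F (𝓝 X)) (c : ℕ) :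
    Tendsto (fun i => ((x i / c : ℕ) : ℝ) / t i) F (𝓝 (X / c)) := by
  have hlower : Tendsto (fun i => x i / t i / c - (t i)⁻¹) F (𝓝 (X / c)) := by
    simpa using (hx.div_const (c : ℝ)).sub ht.inv_tendsto_atTop
  refine tendsto_of_tendsto_of_tendsto_of_le_of_le' hlower (hx.div_const (c : ℝ)) ?_ ?_
  · filter_upwards [ht.eventually_gt_atTop 0] with i hi
    have hfloor : (x i : ℝ) / c - 1 ≤ (x i / c : ℕ) := by
      rw [← Nat.floor_div_eq_div (K := ℝ)]
      exact (Nat.sub_one_lt_floor _).le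
    calc x i / t i / c - (t i)⁻¹ = (x i / c - 1) / t i := by ring
      _ ≤ (x i / c : ℕ) / t i := by gcongr
  · filter_upwards [ht.eventually_gt_atTop 0] with i hi
    calc ((x i / c : ℕ) : ℝ) / t i ≤ x i / c / t i := by gcongr; exact Nat.cast_div_le
      _ = x i / t i / c := div_right_comm _ _ _

theorem nextEntry_le_succ_iff {i : ℕ} (hi : 0 < i) (y q : ℕ) :
    nextEntry i y ≤ q + 1 ↔ y ≤ q + q / i := by
  have hdiv : q + q / i = (i + 1) * q / i := by
    rw [add_mul, one_mul, Nat.mul_add_div hi]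
  rw [hdiv, Nat.le_div_iff_mul_le hi, nextEntry, Nat.add_le_add_iff_right,
    ← Nat.lt_add_one_iff, Nat.div_lt_iff_lt_mul i.succ_pos]
  constructor <;> intro h <;> linarith

theorem finalPair_of_lt {i y : ℕ} (h : i < y) :
    finalPair i y = finalPair (i + 1) (nextEntry i y) := by
  rw [finalPair, if_pos h]

theorem finalPair_of_le {i y : ℕ} (h : y ≤ i) : finalPair i y = (i, y) := by
  rw [finalPair, if_neg h.not_gt]

theorem le_finalPair_fst (i y : ℕ) : i ≤ (finalPair i y).1 := by
  induction i, y using finalPair.induct with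
  | case1 i y h ih => rw [finalPair_of_lt h]; omega
  | case2 i y h => rw [finalPair_of_le (not_lt.1 h)]

theorem finalPair_fst_le_self_iff (i y : ℕ) : (finalPair i y).1 ≤ i ↔ y ≤ i := by
  rcases lt_or_ge i y with h | h
  · rw [finalPair_of_lt h]
    exact iff_of_false (Nat.lt_of_succ_le (le_finalPair_fst _ _)).not_ge h.not_ge
  · rw [finalPair_of_le h]
    exact iff_of_true le_rfl h

theorem finalPair_fst_le_iff_of_succ {i q k : ℕ} (hi : 0 < i) (hq : i ≤ q)
    (hsucc : ∀ y, (finalPair (i + 1) y).1 ≤ k ↔ y ≤ q + 1) (y : ℕ) :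
    (finalPair i y).1 ≤ k ↔ y ≤ q + q / i := by
  rcases lt_or_ge i y with h | h
  · rw [finalPair_of_lt h, hsucc, nextEntry_le_succ_iff hi]
  · have hk : i + 1 ≤ k := (le_finalPair_fst _ _).trans ((hsucc 0).2 (Nat.zero_le _))
    rw [finalPair_of_le h]
    exact iff_of_true (i.le_succ.trans hk) (h.trans (hq.trans (Nat.le_add_right _ _)))

/-- The sequence of pairs run backwards: if a sequence continued from `⟨r + 1, y⟩` ends by a given
index exactly when `y ≤ q + 1`, then one that begins with `⟨1, n⟩` does so exactly when
`n ≤ maxStart r q + 1`. Both entries are shifted by one so that the step from `r + 1` to `r` adds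
`q / (r + 1) - 1` to `q`; no subtraction truncates as long as `r ≤ q`. -/
def maxStart : ℕ → ℕ → ℕ
  | 0, q => q
  | r + 1, q => maxStart r (q + q / (r + 1) - 1)

theorem finalPair_one_fst_le_iff {k r q : ℕ} (hrq : r ≤ q)
    (h : ∀ y, (finalPair (r + 1) y).1 ≤ k ↔ y ≤ q + 1) (n : ℕ) :
    (finalPair 1 n).1 ≤ k ↔ n ≤ maxStart r q + 1 := by
  induction r generalizing q with
  | zero => exact h n
  | succ r ih =>
    have hdiv : 0 < q / (r + 1) := Nat.div_pos hrq r.succ_pos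
    refine ih (by omega) fun y => ?_
    rw [finalPair_fst_le_iff_of_succ r.succ_pos hrq h, Nat.sub_add_cancel (by omega)]

theorem setOf_strangeRoot_lt (m : ℕ) :
    {n : ℕ | 1 ≤ n ∧ strangeRoot n < m + 2} = Set.Icc 1 (maxStart m m + 1) :=
  Set.ext fun n => and_congr_right fun _ => Nat.lt_succ_iff.trans <|
    finalPair_one_fst_le_iff le_rfl (finalPair_fst_le_self_iff (m + 1)) n

theorem ncard_setOf_strangeRoot_lt (m : ℕ) :
    {n : ℕ | 1 ≤ n ∧ strangeRoot n < m + 2}.ncard = maxStart m m + 1 := by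
  simp [setOf_strangeRoot_lt, Set.ncard_eq_toFinset_card']

theorem maxStart_le (r q : ℕ) : maxStart r q ≤ (r + 1) * q := by
  induction r generalizing q with
  | zero => simp [maxStart]
  | succ r ih =>
    calc maxStart (r + 1) q ≤ (r + 1) * (q + q / (r + 1) - 1) := ih _
      _ ≤ (r + 1) * (q + q / (r + 1)) := by gcongr; exact Nat.sub_le _ _
      _ = (r + 1) * q + (r + 1) * (q / (r + 1)) := mul_add _ _ _
      _ ≤ (r + 1) * q + q := by gcongr; exact Nat.mul_div_le _ _
      _ = (r + 1 + 1) * q := by ring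

theorem le_maxStart_add (r q : ℕ) : (r + 1) * q ≤ maxStart r q + r * (r + 1) := by
  induction r generalizing q with
  | zero => simp [maxStart]
  | succ r ih =>
    have hdiv : q ≤ (r + 1) * (q / (r + 1)) + r := by
      have := Nat.lt_mul_div_succ q r.succ_pos
      rw [Nat.succ_eq_add_one, mul_add, mul_one] at this
      omega
    calc (r + 1 + 1) * q = (r + 1) * q + q := by ring
      _ ≤ (r + 1) * q + ((r + 1) * (q / (r + 1)) + r) := by gcongr
      _ = (r + 1) * (q + q / (r + 1)) + r := by ring
      _ ≤ (r + 1) * (q + q / (r + 1) - 1 + 1) + r :=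
        add_le_add_left (Nat.mul_le_mul_left _ le_tsub_add) _
      _ = (r + 1) * (q + q / (r + 1) - 1) + (2 * r + 1) := by ring
      _ ≤ maxStart r (q + q / (r + 1) - 1) + r * (r + 1) + (2 * r + 1) := by
        gcongr
        exact ih _
      _ ≤ maxStart (r + 1) q + (r + 1) * (r + 1 + 1) := by rw [maxStart]; linarith

/-- As long as `q / r = a + 1`, a backward step adds `a` to `q`. -/
theorem maxStart_eq_of_quotient {a r' r q : ℕ} (hr : r' ≤ r) (hq : (a + 1) * r ≤ q)
    (hr' : q + a * r < 2 * (a + 1) * (r' + 1)) :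
    maxStart r q = maxStart r' (q + a * (r - r')) := by
  induction r, hr using Nat.le_induction generalizing q with
  | base => simp
  | succ r hr ih =>
    have hdiv : q / (r + 1) = a + 1 := Nat.div_eq_of_lt_le hq (by nlinarith)
    calc maxStart (r + 1) q = maxStart r (q + a) := by rw [maxStart, hdiv]; rfl
      _ = maxStart r' (q + a + a * (r - r')) := ih (by linarith) (by linarith)
      _ = maxStart r' (q + a * (r + 1 - r')) := by
        rw [Nat.succ_sub hr, Nat.succ_eq_add_one]
        congr 1
        ring

/-- The index at which the quotient `q / r` first exceeds `a + 1` when the backward sequence passes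
through `⟨r, q⟩` with `(a + 1) * r ≤ q`. Up to then `q + a * r` is constant, so the condition at an
index `j ≤ r` is `(a + 2) * j ≤ q + a * r - a * j`. -/
def crossing (a r q : ℕ) : ℕ := min r ((q + a * r) / (2 * (a + 1)))

theorem crossing_le (a r q : ℕ) : crossing a r q ≤ r := min_le_left _ _

theorem maxStart_crossing {a r q : ℕ} (hq : (a + 1) * r ≤ q) :
    maxStart (crossing a r q) (q + a * (r - crossing a r q)) = maxStart r q := by
  rcases le_total r ((q + a * r) / (2 * (a + 1))) with h | h
  · simp [crossing, min_eq_left h]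
  · rw [crossing, min_eq_right h]
    exact (maxStart_eq_of_quotient h hq (Nat.lt_mul_div_succ _ (by positivity))).symm

theorem mul_crossing_le (a r q : ℕ) :
    (a + 2) * crossing a r q ≤ q + a * (r - crossing a r q) := by
  have hfloor : crossing a r q * (2 * (a + 1)) ≤ q + a * r :=
    (Nat.le_div_iff_mul_le (by positivity)).1 (min_le_right _ _)
  obtain ⟨d, hd⟩ := Nat.exists_eq_add_of_le (crossing_le a r q)
  have hsub : r - crossing a r q = d := by omega
  have hmul : a * r = a * crossing a r q + a * d := by rw [← mul_add, ← hd]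
  rw [hsub]
  linarith

theorem tendsto_crossing_div {a : ℕ} {ι : Type*} {F : Filter ι} {r q : ι → ℕ} {t : ι → ℝ} {ρ : ℝ}
    (hρ : 0 ≤ ρ) (ht : Tendsto t F atTop) (hr : Tendsto (fun i => r i / t i) F (𝓝 ρ))
    (hq : Tendsto (fun i => q i / t i) F (𝓝 ((a + 1) * ρ))) :
    Tendsto (fun i => crossing a (r i) (q i) / t i) F (𝓝 ((2 * a + 1) / (2 * (a + 1)) * ρ)) := by
  have hsum : Tendsto (fun i => ((q i + a * r i : ℕ) : ℝ) / t i) F (𝓝 ((2 * a + 1) * ρ)) := by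
    convert! hq.add (hr.const_mul (a : ℝ)) using 2
    · push_cast
      ring
    · ring
  have hmin := hr.min (tendsto_natCast_div_div ht hsum (2 * (a + 1)))
  have hlim : min ρ ((2 * a + 1) * ρ / (2 * (a + 1) : ℕ)) = (2 * a + 1) / (2 * (a + 1)) * ρ := by
    push_cast
    rw [mul_div_right_comm]
    exact min_eq_right (mul_le_of_le_one_left hρ (by rw [div_le_one (by positivity)]; linarith))
  rw [hlim] at hmin
  refine hmin.congr' ?_
  filter_upwards [ht.eventually_ge_atTop 0] with i hi
  rw [min_div_div_right hi, crossing, Nat.cast_min]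

/-- The limit of `r / m`, where `r` is the index at which the quotient first reaches `a + 1` when
the backward sequence starts from `⟨m, m⟩`; see `exists_stage`. -/
noncomputable def stageRatio (a : ℕ) : ℝ := a.centralBinom / 4 ^ a

theorem stageRatio_zero : stageRatio 0 = 1 := by simp [stageRatio]

theorem stageRatio_nonneg (a : ℕ) : 0 ≤ stageRatio a := by rw [stageRatio]; positivity

theorem stageRatio_succ (a : ℕ) :
    stageRatio (a + 1) = (2 * a + 1) / (2 * (a + 1)) * stageRatio a := by
  have h : ((a : ℝ) + 1) * (a + 1).centralBinom = 2 * (2 * a + 1) * a.centralBinom := by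
    exact_mod_cast a.succ_mul_centralBinom_succ
  rw [stageRatio, stageRatio]
  field_simp
  linear_combination 2 * 4 ^ a * h

theorem stageRatio_sq (a : ℕ) : stageRatio a ^ 2 = (Real.Wallis.W a)⁻¹ * (1 + 2 * (a : ℝ))⁻¹ := by
  induction a with
  | zero => simp [stageRatio_zero, Real.Wallis.W]
  | succ a ih =>
    have hW := (Real.Wallis.W_pos a).ne'
    rw [stageRatio_succ, mul_pow, ih, Real.Wallis.W_succ]
    push_cast
    field_simp
    ring

theorem tendsto_add_mul_stageRatio_sq (c : ℝ) :
    Tendsto (fun a : ℕ => (c + a) * stageRatio a ^ 2) atTop (𝓝 Real.pi⁻¹) := by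
  have hfrac : Tendsto (fun a : ℕ => (c + 1 * a) / (1 + 2 * a)) atTop (𝓝 (1 / 2)) :=
    tendsto_add_mul_div_add_mul_atTop_nhds c 1 1 two_ne_zero
  have hwallis := Real.Wallis.tendsto_W_nhds_pi_div_two.inv₀ (by positivity)
  convert! hwallis.mul hfrac using 2 with a
  · rw [stageRatio_sq]
    ring
  · field_simp

theorem exists_stage (a : ℕ) : ∃ r q : ℕ → ℕ,
    (∀ m, (a + 1) * r m ≤ q m ∧ maxStart m m = maxStart (r m) (q m)) ∧
      Tendsto (fun m => (r m : ℝ) / m) atTop (𝓝 (stageRatio a)) ∧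
      Tendsto (fun m => (q m : ℝ) / m) atTop (𝓝 ((a + 1) * stageRatio a)) := by
  induction a with
  | zero =>
    have hself : Tendsto (fun m : ℕ => (m : ℝ) / m) atTop (𝓝 1) := by
      simpa using tendsto_natCast_div_add_atTop (0 : ℝ)
    exact ⟨id, id, by simp, by simpa [stageRatio_zero] using hself,
      by simpa [stageRatio_zero] using hself⟩
  | succ a ih =>
    obtain ⟨r, q, hrq, hr, hq⟩ := ih
    let r' (m : ℕ) : ℕ := crossing a (r m) (q m)
    have hr' : Tendsto (fun m => (r' m : ℝ) / m) atTop (𝓝 (stageRatio (a + 1))) := by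
      rw [stageRatio_succ]
      exact tendsto_crossing_div (stageRatio_nonneg a) tendsto_natCast_atTop_atTop hr hq
    refine ⟨r', fun m => q m + a * (r m - r' m), fun m => ⟨mul_crossing_le a _ _,
      (hrq m).2.trans (maxStart_crossing (hrq m).1).symm⟩, hr', ?_⟩
    convert! hq.add ((hr.sub hr').const_mul (a : ℝ)) using 2 with m
    · rw [Nat.cast_add, Nat.cast_mul, Nat.cast_sub (crossing_le _ _ _)]
      ring
    · rw [stageRatio_succ]
      push_cast
      field_simp
      ring

theorem tendsto_maxStart_div_sq :
    Tendsto (fun m : ℕ => (maxStart m m : ℝ) / m ^ 2) atTop (𝓝 Real.pi⁻¹) := by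
  choose r q hrq hr hq using exists_stage
  have hmain (a) : Tendsto (fun m => ((r a m + 1) * q a m : ℝ) / m ^ 2) atTop
      (𝓝 ((1 + a) * stageRatio a ^ 2)) := by
    convert! ((hr a).add tendsto_inv_atTop_nhds_zero_nat).mul (hq a) using 2 <;> ring
  have herr (a) : Tendsto (fun m => (r a m * (r a m + 1) : ℝ) / m ^ 2) atTop
      (𝓝 (stageRatio a ^ 2)) := by
    convert! (hr a).mul ((hr a).add tendsto_inv_atTop_nhds_zero_nat) using 2 <;> ring
  refine tendsto_of_tendsto_bounds (fun a => (hmain a).sub (herr a)) hmain ?_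
    (tendsto_add_mul_stageRatio_sq 1) (fun a m => ?_) fun a m => ?_
  · exact (tendsto_add_mul_stageRatio_sq 0).congr fun a => by ring
  · rw [(hrq a m).2, ← sub_div]
    gcongr
    rw [sub_le_iff_le_add]
    exact_mod_cast le_maxStart_add (r a m) (q a m)
  · rw [(hrq a m).2]
    gcongr
    exact_mod_cast maxStart_le (r a m) (q a m)

theorem tendsto_ncard_strangeRoot_lt_div_sq :
    Tendsto (fun k : ℕ => ({n : ℕ | 1 ≤ n ∧ strangeRoot n < k}.ncard : ℝ) / k ^ 2) atTop
      (𝓝 Real.pi⁻¹) := by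
  rw [← tendsto_add_atTop_iff_nat 2]
  have hinv : Tendsto (fun m : ℕ => (m : ℝ)⁻¹) atTop (𝓝 0) := tendsto_inv_atTop_nhds_zero_nat
  have hshift : Tendsto (fun m : ℕ => (m : ℝ) / (m + 2)) atTop (𝓝 1) :=
    tendsto_natCast_div_add_atTop 2
  have hlim := (tendsto_maxStart_div_sq.add (hinv.pow 2)).mul (hshift.pow 2)
  rw [zero_pow two_ne_zero, add_zero, one_pow, mul_one] at hlim
  refine hlim.congr' ?_
  filter_upwards [eventually_ne_atTop 0] with m hm
  rw [ncard_setOf_strangeRoot_lt]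
  push_cast
  field_simp

theorem proposition3p5 :
    (∀ k : ℕ, {n : ℕ | 1 ≤ n ∧ strangeRoot n < k}.Finite) ∧
      Asymptotics.IsEquivalent Filter.atTop
        (fun k : ℕ => ({n : ℕ | 1 ≤ n ∧ strangeRoot n < k}.ncard : ℝ))
        (fun k : ℕ => (k : ℝ) ^ 2 / Real.pi) := by
  constructor
  · intro k
    have hfinite : {n : ℕ | 1 ≤ n ∧ strangeRoot n < k + 2}.Finite := by
      rw [setOf_strangeRoot_lt]
      exact Set.finite_Icc _ _
    exact hfinite.subset fun n hn => ⟨hn.1, hn.2.trans (by omega)⟩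
  · refine isEquivalent_of_tendsto_one ?_
    have hlim := tendsto_ncard_strangeRoot_lt_div_sq.mul_const Real.pi
    rw [inv_mul_cancel₀ Real.pi_ne_zero] at hlim
    exact hlim.congr fun k => div_mul _ _ _
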